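/- **Conventions.** Let $(\Omega,\mathcal F,\mathbb P)$ be a probability space with a filtration $(\mathcal F_t)_{t\ge 0}$. A *subordinator* is a $[0,\infty)$-valued process $S_t$, $t\ge 0$, starting from zero, with increasing right-continuous paths and with independent and stationary increments; its *Laplace exponent* is the function $\Phi$ with $\mathbb E\,e^{-\mu S_t}=e^{-t\Phi(\mu)}$ for all $t,\mu\ge 0$. It has *drift* $b\ge 0$ and *Lévy measure* $m$ if $m$ is a measure concentrated on $(0,\infty)$ with $\int_0^\infty(1\wedge x)\,m(dx)<\infty$ and $\Phi(\mu)=b\mu+\int_0^\infty(1-e^{-\mu x})\,m(dx)$ for $\mu\ge 0$. For a random time $\tau$ with values in $[0,\infty)$, $\mathcal F_\tau$ denotes the $\sigma$-algebra generated by the variables $X_\tau$, $X$ a real $(\mathcal F_t)$-adapted càdlàg process (for a stopping time this is the usual $\mathcal F_\tau$). **Theorem.** Let $\eta>0$, $\delta>0$, $n=\lceil\delta\rceil$, and let $\nu$ be such that $\nu r\in(0,1)$ for $r=1,\dots,n$. Let $V^{\nu r}_t$, $r=1,\dots,n$, be independent $(\mathcal F_t)$-adapted stable subordinators, $V^{\nu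 r}$ having Laplace exponent $\mu^{\nu r}$, and put $${}_\eta\mathcal V_t^{\nu,n}=\sum_{r=1}^n\binom nr^{\frac1{\nu r}}\eta^{\frac{n-r}{\nu r}}\,V_t^{\nu r},\qquad t\ge 0.$$ Let $\mathscr V_t^{\delta/n}$ be a tempered $\delta/n$-stable subordinator, independent of $(V^{\nu 1},\dots,V^{\nu n})$, with Laplace exponent $(\eta^n+\mu)^{\delta/n}-\eta^\delta$ (for $\delta=n$ this is $\mu$, i.e. $\mathscr V_t=t$ almost surely). Then the subordinated process $${}_\eta\mathfrak V_t^{\nu,\delta}={}_\eta\mathcal V^{\nu,n}_{\mathscr V_t^{\delta/n}},\qquad t\ge 0,$$ is adapted to $\mathcal G_t=\mathcal F_{\mathscr V_t^{\delta/n}}$, in the sense that ${}_\eta\mathfrak V_t^{\nu,\delta}$ is $\mathcal G_t$-measurable for every $t\ge0$, and it is a subordinator, with Laplace exponent $$\Phi(\mu)=(\eta+\mu^\nu)^\delta-\eta^\delta,\qquad \mu\ge 0.$$ Furthermore, if $\delta<n$ (that is, $\delta$ is not an integer), then its drift is zero and its Lévy measure is $$m(dx)=\int_0^\infty e^{-\eta^n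 t}\,\mathbb P\bigl({}_\eta\mathcal V_t^{\nu,n}\in dx\bigr)\,\frac{\delta}{n}\,\frac{t^{-(1+\delta/n)}}{\Gamma(1-\delta/n)}\,dt .$$ -/

import Mathlib

open MeasureTheory ProbabilityTheory Filter Topology
open scoped NNReal ENNReal

/-- A (strict) subordinator `S_t`, `t ≥ 0`: an increasing Lévy process, i.e. a process starting from
zero, with increasing right-continuous paths and with independent and stationary increments.
The process is `[0, ∞)`-valued; since paths are increasing, the truncated subtraction of `ℝ≥0`
computes the genuine increments `S t - S s` for `s ≤ t`. -/
structure IsSubordinator {Ω : Type*} [MeasurableSpace Ω] (P : Measure Ω)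
    (S : ℝ≥0 → Ω → ℝ≥0) : Prop where
  measurable : ∀ t, Measurable (S t)
  zero : ∀ ω, S 0 ω = 0
  mono : ∀ ω, Monotone fun t ↦ S t ω
  right_cont : ∀ ω t, ContinuousWithinAt (fun u ↦ S u ω) (Set.Ici t) t
  indep_increments : HasIndepIncrements S P
  stationary_increments : ∀ s t, s ≤ t →
    IdentDistrib (fun ω ↦ S t ω - S s ω) (S (t - s)) P P

/-- `Φ` is the Laplace exponent of `S`: `𝔼 exp (-μ S_t) = exp (-t Φ(μ))` for `t, μ ≥ 0`. -/
def HasLaplaceExponent {Ω : Type*} [MeasurableSpace Ω] (P : Measure Ω)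
    (S : ℝ≥0 → Ω → ℝ≥0) (Φ : ℝ≥0 → ℝ) : Prop :=
  ∀ t μ : ℝ≥0, ∫ ω, Real.exp (-((μ : ℝ) * (S t ω : ℝ))) ∂P = Real.exp (-((t : ℝ) * Φ μ))

/-- `α`-stable subordinator: Laplace exponent `μ ^ α`. -/
structure IsStableSubordinator {Ω : Type*} [MeasurableSpace Ω] (P : Measure Ω) (α : ℝ)
    (S : ℝ≥0 → Ω → ℝ≥0) : Prop where
  isSubordinator : IsSubordinator P S
  laplace : HasLaplaceExponent P S fun μ ↦ (μ : ℝ) ^ α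

/-- Tempered `α`-stable subordinator with tempering parameter `ξ`:
Laplace exponent `(ξ + μ) ^ α - ξ ^ α`. -/
structure IsTemperedStableSubordinator {Ω : Type*} [MeasurableSpace Ω] (P : Measure Ω) (α ξ : ℝ)
    (S : ℝ≥0 → Ω → ℝ≥0) : Prop where
  isSubordinator : IsSubordinator P S
  laplace : HasLaplaceExponent P S fun μ ↦ (ξ + (μ : ℝ)) ^ α - ξ ^ α

/-- `S` has drift `b` and Lévy measure `m`, in the sense of the Lévy-Khintchine formula:
`m` is concentrated on `(0, ∞)`, `∫ (1 ∧ x) m(dx) < ∞`, and the Laplace exponent of `S` is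
`b μ + ∫ (1 - e^{-μ x}) m(dx)`. -/
structure HasDriftAndLevyMeasure {Ω : Type*} [MeasurableSpace Ω] (P : Measure Ω)
    (S : ℝ≥0 → Ω → ℝ≥0) (b : ℝ≥0) (m : Measure ℝ≥0) : Prop where
  concentrated : m {0} = 0
  lintegral_lt_top : ∫⁻ x, min 1 (x : ℝ≥0∞) ∂m < ∞
  laplace : HasLaplaceExponent P S fun μ ↦
    (b : ℝ) * (μ : ℝ) + ∫ x : ℝ≥0, (1 - Real.exp (-((μ : ℝ) * (x : ℝ)))) ∂m

/-- The weighted sum `∑_{r=1}^n C(n,r)^{1/(νr)} η^{(n-r)/(νr)} V_t^{νr}`, where `V r` stands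
for `V^{νr}`. -/
noncomputable def weightedSum {Ω : Type*} (η : ℝ≥0) (ν : ℝ) (n : ℕ)
    (V : Finset.Icc 1 n → ℝ≥0 → Ω → ℝ≥0) (t : ℝ≥0) (ω : Ω) : ℝ≥0 :=
  ∑ r : Finset.Icc 1 n,
    (n.choose (r : ℕ) : ℝ≥0) ^ (1 / (ν * ((r : ℕ) : ℝ))) *
      η ^ (((n : ℝ) - ((r : ℕ) : ℝ)) / (ν * ((r : ℕ) : ℝ))) * V r t ω

/-- The process `S` evaluated at the random time `T`, that is `S_{T_t}`. -/
def timeChange {Ω : Type*} (S T : ℝ≥0 → Ω → ℝ≥0) (t : ℝ≥0) (ω : Ω) : ℝ≥0 :=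
  S (T t ω) ω

/-- The σ-algebra `𝓕_τ` at a random time `τ` (not necessarily a stopping time): it is generated by
the variables `X_τ`, for `X` a real-valued `𝓕`-adapted process with càdlàg paths. For a stopping
time it is the usual σ-algebra of events prior to `τ`, see `sigmaAt_eq_of_isStoppingTime`. -/
@[reducible]
def sigmaAt {Ω : Type*} {mΩ : MeasurableSpace Ω} (𝓕 : Filtration ℝ≥0 mΩ) (τ : Ω → ℝ≥0) :
    MeasurableSpace Ω :=
  ⨆ (X : ℝ≥0 → Ω → ℝ) (_ : (∀ t, Measurable[𝓕 t] (X t)) ∧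
      (∀ ω t, ContinuousWithinAt (fun u ↦ X u ω) (Set.Ici t) t) ∧
      (∀ ω t, ∃ l : ℝ, Tendsto (fun u ↦ X u ω) (𝓝[<] t) (𝓝 l))),
    MeasurableSpace.comap (fun ω ↦ X (τ ω) ω) inferInstance

/-- Joint measurability on `[0, i] × Ω` of a right-continuous process. -/
theorem measurable_uncurry_Iic_of_right_cont {Ω : Type*} [MeasurableSpace Ω] (i : ℝ≥0)
    (X : ℝ≥0 → Ω → ℝ) (hX : ∀ t ≤ i, Measurable (X t))
    (hXc : ∀ ω t, ContinuousWithinAt (fun u ↦ X u ω) (Set.Ici t) t) :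
    Measurable fun p : Set.Iic i × Ω ↦ X p.1 p.2 := by
  obtain ⟨N, hN⟩ : ∃ N : ℕ → ℝ≥0 → ℕ, N = fun (k : ℕ) s ↦ ⌊s * ((k : ℝ≥0) + 1)⌋₊ := ⟨_, rfl⟩
  obtain ⟨c, hc⟩ : ∃ c : ℕ → ℕ → ℝ≥0, c = fun (k j : ℕ) ↦ min i (((j : ℝ≥0) + 1) / (k + 1)) := ⟨_, rfl⟩
  have hci : ∀ k j, c k j ≤ i := fun k j ↦ by rw [hc]; exact min_le_left _ _
  have ha : ∀ k s, s ≤ i → s ≤ c k (N k s) := fun k s hs ↦ by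
    rw [hc, hN]
    refine le_min hs ?_
    rw [le_div_iff₀ (by positivity)]
    exact (Nat.lt_floor_add_one _).le
  have ha2 : ∀ k s, c k (N k s) ≤ s + 1 / (k + 1) := fun k s ↦ by
    rw [hc, hN]
    refine (min_le_right _ _).trans ?_
    rw [div_le_iff₀ (by positivity), add_mul, one_div, inv_mul_cancel₀ (by positivity)]
    gcongr
    exact Nat.floor_le zero_le
  have hNm : ∀ k, Measurable (N k) := fun k ↦ by rw [hN]; fun_prop
  refine measurable_of_tendsto_metrizable
    (f := fun k (p : Set.Iic i × Ω) ↦ X (c k (N k p.1)) p.2) (fun k ↦ ?_) ?_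
  · have hb : Measurable fun p : Set.Iic i × Ω ↦ (N k p.1, p.2) :=
      ((hNm k).comp (measurable_subtype_coe.comp measurable_fst)).prodMk measurable_snd
    have hd : Measurable fun q : ℕ × Ω ↦ X (c k q.1) q.2 :=
      measurable_from_prod_countable_right fun j ↦ hX (c k j) (hci k j)
    exact Measurable.comp (g := fun q : ℕ × Ω ↦ X (c k q.1) q.2)
      (f := fun p : Set.Iic i × Ω ↦ (N k p.1, p.2)) hd hb
  · rw [tendsto_pi_nhds]
    rintro ⟨⟨s, hs⟩, ω⟩
    refine (hXc ω s).tendsto.comp (tendsto_nhdsWithin_iff.2 ⟨?_, .of_forall fun k ↦ ha k s hs⟩)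
    refine tendsto_of_tendsto_of_tendsto_of_le_of_le (g := fun _ ↦ s)
      (h := fun k : ℕ ↦ s + 1 / ((k : ℝ≥0) + 1)) tendsto_const_nhds ?_
      (fun k ↦ ha k s hs) (fun k ↦ ha2 k s)
    simpa using tendsto_const_nhds.add (tendsto_one_div_add_atTop_nhds_zero_nat (𝕜 := ℝ≥0))

/-- For a (finite) stopping time, `sigmaAt` is the usual σ-algebra of events prior to it. -/
theorem sigmaAt_eq_of_isStoppingTime {Ω : Type*} {mΩ : MeasurableSpace Ω}
    (𝓕 : Filtration ℝ≥0 mΩ) (τ : Ω → ℝ≥0)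
    (hτ : IsStoppingTime 𝓕 (fun ω ↦ (τ ω : WithTop ℝ≥0))) :
    sigmaAt 𝓕 τ = hτ.measurableSpace := by
  apply le_antisymm
  · refine iSup₂_le fun X hX ↦ ?_
    obtain ⟨h1, h2, -⟩ := hX
    have prog : IsStronglyProgressive 𝓕 X := fun i ↦
      (@measurable_uncurry_Iic_of_right_cont Ω (𝓕 i) i X
        (fun t ht ↦ (h1 t).mono (𝓕.mono ht) le_rfl) h2).stronglyMeasurable
    have := measurable_stoppedValue prog hτ
    exact this.comap_le
  · intro A hA
    classical
    let X : ℝ≥0 → Ω → ℝ := fun t ω ↦ if ω ∈ A ∧ τ ω ≤ t then 1 else 0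
    have hX : MeasurableSpace.comap (fun ω ↦ X (τ ω) ω) inferInstance ≤ sigmaAt 𝓕 τ := by
      refine le_iSup₂_of_le X ⟨fun t ↦ ?_, fun ω t ↦ ?_, fun ω t ↦ ?_⟩ le_rfl
      · refine Measurable.ite ?_ measurable_const measurable_const
        have := hA.2 t
        simp only [WithTop.coe_le_coe] at this
        exact this
      · by_cases h : ω ∈ A ∧ τ ω ≤ t
        · refine (continuousWithinAt_const (b := (1 : ℝ))).congr (fun u hu ↦ ?_) ?_
          · exact if_pos ⟨h.1, h.2.trans hu⟩
          · exact if_pos h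
        · have : ∀ᶠ u in 𝓝 t, ¬ (ω ∈ A ∧ τ ω ≤ u) := by
            by_cases hω : ω ∈ A
            · filter_upwards [Iio_mem_nhds (not_le.1 fun h' ↦ h ⟨hω, h'⟩)] with u hu h'
              exact absurd h'.2 (not_le.2 hu)
            · exact .of_forall fun u h' ↦ hω h'.1
          refine ContinuousAt.continuousWithinAt ?_
          refine (continuousAt_const (y := (0 : ℝ))).congr ?_
          filter_upwards [this] with u hu
          exact (if_neg hu).symm
      · by_cases h : ω ∈ A ∧ τ ω < t
        · refine ⟨1, tendsto_const_nhds.congr' ?_⟩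
          filter_upwards [mem_nhdsWithin_of_mem_nhds (Ioi_mem_nhds h.2)] with u hu
          exact (if_pos ⟨h.1, le_of_lt hu⟩).symm
        · refine ⟨0, tendsto_const_nhds.congr' ?_⟩
          filter_upwards [self_mem_nhdsWithin] with u hu
          exact (if_neg fun h' ↦ h ⟨h'.1, lt_of_le_of_lt h'.2 hu⟩).symm
    refine hX _ ⟨{1}, measurableSet_singleton _, ?_⟩
    ext ω
    by_cases h : ω ∈ A <;> simp [X, h]

/-!
Write `W` for the weighted sum. As a nonnegative combination of independent subordinators, `W` is a
subordinator (`IsSubordinator.sum_mul`), and the weights are chosen so that by the binomial theorem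
its Laplace exponent is `ψ(μ) = (η + μ^ν)^n - η^n` (`sum_weight_mul_rpow`).

Since `W` and `T` are independent, `T` can be frozen in expectations of functionals of `W_T`
(`lintegral_process_of_indepFun`). Given `T`, the increments of `W_T` are independent and
distributed as `W` at the lengths of the increments of `T`. So the probability of a product event
for increments of `W_T` is the expectation of a product of functions of the separate increments of
`T`, which factorizes and depends only on the lengths of the time intervals: `W_T` is again a
subordinator (`IsSubordinator.timeChange`), with no appeal to uniqueness of Laplace transforms. In
the same way its Laplace exponent is the composition of the exponents of `T` and `W`, which is
`(η^n + ψ(μ))^{δ/n} - η^δ = (η + μ^ν)^δ - η^δ`. Adaptedness is immediate from the definition of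
`sigmaAt`, as `W` is itself càdlàg and adapted.

For `δ < n`, the claimed Lévy measure mixes the laws of `W t` over the Lévy measure
`e^{-ξt} α t^{-1-α} / Γ(1-α) dt` of `T`, with `α = δ/n` and `ξ = η^n`. By Tonelli's theorem its
Lévy-Khintchine integral at `μ` is that of `T` at `ψ(μ)`, which is computed in
`lintegral_exp_sub_exp_mul_rpow`. Since `1 ∧ x ≤ 2 (1 - e^{-x})`, this also gives the integrability
condition, and the measure does not charge `0` because `ψ(μ) → ∞`
(`measure_eq_zero_of_tendsto_laplaceExponent`).
-/

/-! ### Conditioning a process on independent random times -/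

/-- Joint measurability on `ℝ≥0 × Ω` of a right-continuous process, by stopping it at the times
`k : ℕ`. -/
theorem measurable_uncurry_of_right_cont {Ω : Type*} [MeasurableSpace Ω] {X : ℝ≥0 → Ω → ℝ≥0}
    (hX : ∀ t, Measurable (X t))
    (hXc : ∀ ω t, ContinuousWithinAt (fun u ↦ X u ω) (Set.Ici t) t) :
    Measurable fun p : ℝ≥0 × Ω ↦ X p.1 p.2 := by
  have key : ∀ k : ℕ, Measurable fun p : ℝ≥0 × Ω ↦ ((X (min p.1 k) p.2 : ℝ≥0) : ℝ) := fun k ↦ by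
    have h := measurable_uncurry_Iic_of_right_cont (k : ℝ≥0) (fun t ω ↦ (X t ω : ℝ))
      (fun t _ ↦ (hX t).coe_nnreal_real)
      (fun ω t ↦ NNReal.continuous_coe.continuousAt.comp_continuousWithinAt (hXc ω t))
    have hg : Measurable fun p : ℝ≥0 × Ω ↦
        ((⟨min p.1 k, Set.mem_Iic.2 (min_le_right _ _)⟩ : Set.Iic (k : ℝ≥0)), p.2) :=
      (Measurable.subtype_mk (by fun_prop)).prodMk measurable_snd
    exact h.comp hg
  have lim : Measurable fun p : ℝ≥0 × Ω ↦ ((X p.1 p.2 : ℝ≥0) : ℝ) := by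
    refine measurable_of_tendsto_metrizable key (tendsto_pi_nhds.2 fun p ↦ ?_)
    refine tendsto_const_nhds.congr' ?_
    obtain ⟨N, hN⟩ := exists_nat_ge p.1
    filter_upwards [eventually_ge_atTop N] with k hk
    rw [min_eq_left (hN.trans (by exact_mod_cast hk))]
  simpa using lim.real_toNNReal

/-- If `Y` and `Z` are independent, the expectation of `f (Y, Z)` may be computed by freezing
`Y`. -/
theorem lintegral_comp_of_indepFun {Ω E F : Type*} {mΩ : MeasurableSpace Ω}
    {mE : MeasurableSpace E} {mF : MeasurableSpace F} {P : Measure Ω} [IsProbabilityMeasure P]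
    {Y : Ω → E} {Z : Ω → F} (hY : Measurable Y) (hZ : Measurable Z) (hind : IndepFun Y Z P)
    {f : E × F → ℝ≥0∞} (hf : Measurable f) :
    ∫⁻ ω, f (Y ω, Z ω) ∂P = ∫⁻ ω, ∫⁻ ω', f (Y ω, Z ω') ∂P ∂P := by
  have := Measure.isProbabilityMeasure_map (μ := P) hZ.aemeasurable
  calc ∫⁻ ω, f (Y ω, Z ω) ∂P
      = ∫⁻ p, f p ∂(P.map fun ω ↦ (Y ω, Z ω)) := (lintegral_map hf (hY.prodMk hZ)).symm
    _ = ∫⁻ y, ∫⁻ z, f (y, z) ∂(P.map Z) ∂(P.map Y) := by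
        rw [(indepFun_iff_map_prod_eq_prod_map_map hY.aemeasurable hZ.aemeasurable).1 hind,
          lintegral_prod _ hf.aemeasurable]
    _ = ∫⁻ ω, ∫⁻ z, f (Y ω, z) ∂(P.map Z) ∂P := lintegral_map hf.lintegral_prod_right' hY
    _ = _ := lintegral_congr fun ω ↦ lintegral_map (hf.comp measurable_prodMk_left) hZ

theorem lintegral_process_comp_of_indepFun {Ω E F : Type*} {mΩ : MeasurableSpace Ω}
    {mE : MeasurableSpace E} {mF : MeasurableSpace F} {P : Measure Ω} [IsProbabilityMeasure P]
    {W : ℝ≥0 → F → ℝ≥0} (hW : ∀ t, Measurable (W t))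
    (hWc : ∀ x t, ContinuousWithinAt (fun u ↦ W u x) (Set.Ici t) t)
    {Y : Ω → E} {Z : Ω → F} (hY : Measurable Y) (hZ : Measurable Z) (hind : IndepFun Y Z P)
    {ι : Type*} {τ : ι → E → ℝ≥0} (hτ : ∀ i, Measurable (τ i))
    {g : (ι → ℝ≥0) → ℝ≥0∞} (hg : Measurable g) :
    ∫⁻ ω, g (fun i ↦ W (τ i (Y ω)) (Z ω)) ∂P =
      ∫⁻ ω, ∫⁻ ω', g (fun i ↦ W (τ i (Y ω)) (Z ω')) ∂P ∂P := by
  refine lintegral_comp_of_indepFun (f := fun p : E × F ↦ g fun i ↦ W (τ i p.1) p.2) hY hZ hind ?_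
  exact hg.comp (measurable_pi_lambda _ fun i ↦ (measurable_uncurry_of_right_cont hW hWc).comp
    (((hτ i).comp measurable_fst).prodMk measurable_snd))

/-- A process with right-continuous paths may be conditioned on independent random data `Y`, even
when it is evaluated at random times that depend on `Y`. This is
`lintegral_process_comp_of_indepFun` for the identity map into `Ω` with the σ-algebra generated by
the process: with respect to that σ-algebra the process is jointly measurable in time and `ω`,
whereas evaluation of paths is not jointly measurable on the path space `ℝ≥0 → ℝ≥0`. -/
theorem lintegral_process_of_indepFun {Ω E : Type*} {mΩ : MeasurableSpace Ω}
    {mE : MeasurableSpace E} {P : Measure Ω} [IsProbabilityMeasure P]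
    {W : ℝ≥0 → Ω → ℝ≥0} (hW : ∀ t, Measurable (W t))
    (hWc : ∀ ω t, ContinuousWithinAt (fun u ↦ W u ω) (Set.Ici t) t)
    {Y : Ω → E} (hY : Measurable Y) (hind : IndepFun (fun ω t ↦ W t ω) Y P)
    {ι : Type*} {τ : ι → E → ℝ≥0} (hτ : ∀ i, Measurable (τ i))
    {g : (ι → ℝ≥0) → ℝ≥0∞} (hg : Measurable g) :
    ∫⁻ ω, g (fun i ↦ W (τ i (Y ω)) ω) ∂P = ∫⁻ ω, ∫⁻ ω', g (fun i ↦ W (τ i (Y ω)) ω') ∂P ∂P := by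
  refine @lintegral_process_comp_of_indepFun Ω E Ω mΩ mE (.comap (fun ω t ↦ W t ω) inferInstance)
    P _ W (fun t ↦ ?_) hWc Y id hY ?_ ?_ ι τ hτ g hg
  · exact (measurable_pi_apply t).comp (comap_measurable fun ω t ↦ W t ω)
  · exact measurable_id'' (measurable_pi_lambda _ hW).comap_le
  · refine (@IndepFun_iff_Indep Ω E Ω mΩ mE (.comap (fun ω t ↦ W t ω) inferInstance) Y id P).2 ?_
    rw [MeasurableSpace.comap_id]
    exact ((IndepFun_iff_Indep (fun ω t ↦ W t ω) Y P).1 hind).symm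

/-! ### Subordination -/

section TimeChange
variable {Ω : Type*} [MeasurableSpace Ω] {P : Measure Ω} {W T : ℝ≥0 → Ω → ℝ≥0}

theorem measurable_timeChange (hW : IsSubordinator P W) (hT : IsSubordinator P T) (t : ℝ≥0) :
    Measurable (timeChange W T t) :=
  (measurable_uncurry_of_right_cont hW.measurable hW.right_cont).comp
    ((hT.measurable t).prodMk measurable_id)

variable [IsProbabilityMeasure P]

theorem measurable_measure_preimage (hW : IsSubordinator P W) {B : Set ℝ≥0}
    (hB : MeasurableSet B) : Measurable fun d ↦ P (W d ⁻¹' B) :=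
  measurable_measure_prodMk_left
    (measurable_uncurry_of_right_cont hW.measurable hW.right_cont hB)

/-- Conditionally on `T`, the increments of `W_T` are independent, and each has the law of `W` at
the length of the corresponding increment of `T`. -/
theorem measure_biInter_timeChange_increments (hW : IsSubordinator P W) (hT : IsSubordinator P T)
    (hind : IndepFun (fun ω t ↦ W t ω) (fun ω t ↦ T t ω) P) {n : ℕ} {t : Fin (n + 1) → ℝ≥0}
    (ht : Monotone t) (S : Finset (Fin n)) {B : Fin n → Set ℝ≥0}
    (hB : ∀ i ∈ S, MeasurableSet (B i)) :
    P (⋂ i ∈ S, (fun ω ↦ timeChange W T (t i.succ) ω - timeChange W T (t i.castSucc) ω) ⁻¹' B i) =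
      ∫⁻ ω, ∏ i ∈ S, P (W (T (t i.succ) ω - T (t i.castSucc) ω) ⁻¹' B i) ∂P := by
  have hA : MeasurableSet {x : Fin (n + 1) → ℝ≥0 | ∀ i ∈ S, x i.succ - x i.castSucc ∈ B i} := by
    have : {x : Fin (n + 1) → ℝ≥0 | ∀ i ∈ S, x i.succ - x i.castSucc ∈ B i} =
        ⋂ i ∈ S, (fun x ↦ x i.succ - x i.castSucc) ⁻¹' B i := by
      ext x
      simp
    rw [this]
    exact S.measurableSet_biInter fun i hi ↦ (hB i hi).preimage (by fun_prop)
  have hYm : Measurable fun ω (i : Fin (n + 1)) ↦ T (t i) ω :=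
    measurable_pi_lambda _ fun i ↦ hT.measurable _
  have hYi : IndepFun (fun ω t ↦ W t ω) (fun ω (i : Fin (n + 1)) ↦ T (t i) ω) P :=
    hind.comp (φ := id) (ψ := fun (f : ℝ≥0 → ℝ≥0) (i : Fin (n + 1)) ↦ f (t i)) measurable_id
      (by fun_prop)
  have h := lintegral_process_of_indepFun hW.measurable hW.right_cont hYm hYi
    (τ := fun i y ↦ y i) (fun i ↦ measurable_pi_apply i)
    (g := Set.indicator {x : Fin (n + 1) → ℝ≥0 | ∀ i ∈ S, x i.succ - x i.castSucc ∈ B i} 1)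
    (measurable_one.indicator hA)
  have hset : MeasurableSet (⋂ i ∈ S, (fun ω ↦ timeChange W T (t i.succ) ω -
      timeChange W T (t i.castSucc) ω) ⁻¹' B i) :=
    S.measurableSet_biInter fun i hi ↦ ((measurable_timeChange hW hT _).sub
      (measurable_timeChange hW hT _)) (hB i hi)
  rw [← lintegral_indicator_one hset]
  classical
  convert h using 1
  · refine lintegral_congr fun ω ↦ ?_
    simp [Set.indicator_apply, timeChange]
  · refine lintegral_congr fun ω ↦ ?_
    have hmono : Monotone fun i ↦ T (t i) ω := (hT.mono ω).comp ht
    have hinc := (hW.indep_increments n _ hmono).measure_inter_preimage_eq_mul S hB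
    have hstat : ∀ i ∈ S, P ((fun ω' ↦ W (T (t i.succ) ω) ω' - W (T (t i.castSucc) ω) ω') ⁻¹' B i)
        = P (W (T (t i.succ) ω - T (t i.castSucc) ω) ⁻¹' B i) := fun i hi ↦
      (hW.stationary_increments _ _ (hmono (Fin.castSucc_le_succ i))).measure_mem_eq (hB i hi)
    rw [← Finset.prod_congr rfl hstat, ← hinc, ← lintegral_indicator_one]
    · refine lintegral_congr fun ω' ↦ ?_
      simp [Set.indicator_apply]
    · exact S.measurableSet_biInter fun i hi ↦ ((hW.measurable _).sub (hW.measurable _)) (hB i hi)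

theorem measure_timeChange_sub (hW : IsSubordinator P W) (hT : IsSubordinator P T)
    (hind : IndepFun (fun ω t ↦ W t ω) (fun ω t ↦ T t ω) P) {s t : ℝ≥0} (hst : s ≤ t)
    {B : Set ℝ≥0} (hB : MeasurableSet B) :
    P ((fun ω ↦ timeChange W T t ω - timeChange W T s ω) ⁻¹' B) =
      ∫⁻ ω, P (W (T (t - s) ω) ⁻¹' B) ∂P := by
  have ht : Monotone ![s, t] := by
    refine Fin.monotone_iff_le_succ.2 fun i ↦ ?_
    fin_cases i
    exact hst
  have h := measure_biInter_timeChange_increments hW hT hind ht {0} (B := fun _ ↦ B)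
    fun _ _ ↦ hB
  simp only [Finset.mem_singleton, Set.iInter_iInter_eq_left, Finset.prod_singleton] at h
  exact h.trans ((hT.stationary_increments s t hst).comp
    (measurable_measure_preimage hW hB)).lintegral_eq

/-- Bochner subordination. By `measure_biInter_timeChange_increments`, the probability of a product
event for the increments of `W_T` is the expectation of a product of functions of the increments of
`T`, which factorizes because those are independent. -/
theorem IsSubordinator.timeChange (hW : IsSubordinator P W) (hT : IsSubordinator P T)
    (hind : IndepFun (fun ω t ↦ W t ω) (fun ω t ↦ T t ω) P) :
    IsSubordinator P (timeChange W T) where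
  measurable := measurable_timeChange hW hT
  zero ω := by rw [_root_.timeChange, hT.zero, hW.zero]
  mono ω := (hW.mono ω).comp (hT.mono ω)
  right_cont ω t := ContinuousWithinAt.comp (f := fun u ↦ T u ω) (g := fun u ↦ W u ω)
    (hW.right_cont ω (T t ω)) (hT.right_cont ω t) fun _ hu ↦ hT.mono ω hu
  indep_increments := by
    intro n t ht
    rw [iIndepFun_iff_measure_inter_preimage_eq_mul]
    intro S B hB
    rw [measure_biInter_timeChange_increments hW hT hind ht S hB]
    -- Off `S` the sets `B i` need not be measurable; they play no role and are replaced by `∅`.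
    have hB' : ∃ B' : Fin n → Set ℝ≥0, (∀ i, MeasurableSet (B' i)) ∧ ∀ i ∈ S, B' i = B i := by
      classical
      refine ⟨fun i ↦ if i ∈ S then B i else ∅, fun i ↦ ?_, fun i hi ↦ if_pos hi⟩
      by_cases hi : i ∈ S
      · simpa [hi] using hB i hi
      · simp [hi]
    obtain ⟨B', hB'm, hB'B⟩ := hB'
    have hprod := lintegral_prod_eq_prod_lintegral_of_indepFun S _
      ((hT.indep_increments n t ht).comp (fun i d ↦ P (W d ⁻¹' B' i))
        fun i ↦ measurable_measure_preimage hW (hB'm i))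
      fun i ↦ (measurable_measure_preimage hW (hB'm i)).comp
        ((hT.measurable _).sub (hT.measurable _))
    have e1 : ∀ ω, ∏ i ∈ S, P (W (T (t i.succ) ω - T (t i.castSucc) ω) ⁻¹' B i) =
        ∏ i ∈ S, P (W (T (t i.succ) ω - T (t i.castSucc) ω) ⁻¹' B' i) := fun ω ↦
      Finset.prod_congr rfl fun i hi ↦ by rw [hB'B i hi]
    simp_rw [e1]
    refine hprod.trans (Finset.prod_congr rfl fun i hi ↦ ?_)
    have h := measure_biInter_timeChange_increments hW hT hind ht {i} (B := B')
      fun i _ ↦ hB'm i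
    simp only [Finset.mem_singleton, Set.iInter_iInter_eq_left, Finset.prod_singleton] at h
    rw [← hB'B i hi, h]
    rfl
  stationary_increments s t hst := by
    have hm : Measurable fun ω ↦ _root_.timeChange W T t ω - _root_.timeChange W T s ω :=
      (measurable_timeChange hW hT t).sub (measurable_timeChange hW hT s)
    refine ⟨hm.aemeasurable, (measurable_timeChange hW hT _).aemeasurable,
      Measure.ext fun B hB ↦ ?_⟩
    rw [Measure.map_apply hm hB,
      Measure.map_apply (measurable_timeChange hW hT _) hB,
      measure_timeChange_sub hW hT hind hst hB]
    have h := measure_timeChange_sub hW hT hind (zero_le (a := t - s)) hB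
    have h0 : ∀ ω, _root_.timeChange W T 0 ω = 0 := fun ω ↦ by
      rw [_root_.timeChange, hT.zero, hW.zero]
    simp only [h0, tsub_zero] at h
    exact h.symm

end TimeChange

/-! ### Combinations of independent subordinators -/

/-- If all entries of a matrix of random variables are independent, then so are its columns. -/
theorem iIndepFun_pi_columns {Ω ι κ : Type*} [MeasurableSpace Ω] {P : Measure Ω}
    [Finite κ] {E : κ → ι → Type*} [∀ r i, MeasurableSpace (E r i)]
    {Z : (r : κ) → (i : ι) → Ω → E r i} (mZ : ∀ r i, Measurable (Z r i))
    (hZ : iIndepFun (fun (p : κ × ι) ω ↦ Z p.1 p.2 ω) P) :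
    iIndepFun (fun i ω (r : κ) ↦ Z r i ω) P := by
  have := hZ.isProbabilityMeasure
  have := Fintype.ofFinite κ
  rw [iIndepFun_iff_iIndep]
  refine iIndepSets.iIndep (π := fun i ↦ {s | ∃ t ∈ Set.pi Set.univ ''
      Set.pi Set.univ (fun r ↦ {s : Set (E r i) | MeasurableSet s}),
      (fun ω r ↦ Z r i ω) ⁻¹' t = s}) ?_ ?_ ?_ ?_
  · exact fun i ↦ (measurable_pi_lambda _ fun r ↦ mZ r i).comap_le
  · exact fun i ↦ (isPiSystem_pi).comap _
  · intro i
    rw [← generateFrom_pi, MeasurableSpace.comap_generateFrom]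
    rfl
  · rw [iIndepSets_iff]
    intro S f hf
    -- Each `f i` is a rectangle `⋂ r, Z r i ⁻¹' B i r`, and so is the intersection of the `f i`.
    choose! t ht hft using hf
    choose! B hB hBt using ht
    have hfi : ∀ i ∈ S, f i = ⋂ r ∈ (Finset.univ : Finset κ), Z r i ⁻¹' B i r := by
      intro i hi
      rw [← hft i hi, ← hBt i hi]
      ext ω
      simp
    have hm : ∀ p : κ × ι, p.2 ∈ S → MeasurableSet (B p.2 p.1) :=
      fun p hp ↦ hB p.2 hp p.1 (Set.mem_univ _)
    have hone : ∀ i ∈ S, P (f i) = ∏ r : κ, P (Z r i ⁻¹' B i r) := by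
      intro i hi
      rw [hfi i hi]
      exact (hZ.precomp (g := fun r ↦ (r, i)) fun a b h ↦ congrArg Prod.fst h
        ).measure_inter_preimage_eq_mul (sets := fun r ↦ B i r) _ fun r _ ↦ hm (r, i) hi
    have hall := hZ.measure_inter_preimage_eq_mul (sets := fun p ↦ B p.2 p.1)
      (Finset.univ ×ˢ S) fun p hp ↦ hm p (Finset.mem_product.1 hp).2
    rw [Finset.prod_product_right] at hall
    rw [Finset.prod_congr rfl hone, ← hall]
    congr 1
    ext ω
    simp only [Set.mem_iInter]
    constructor
    · intro h p hp
      have h2 := h p.2 (Finset.mem_product.1 hp).2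
      rw [hfi p.2 (Finset.mem_product.1 hp).2] at h2
      simpa using Set.mem_iInter₂.1 h2 p.1 (Finset.mem_univ _)
    · intro h i hi
      rw [hfi i hi]
      simp only [Set.mem_iInter]
      exact fun r _ ↦ h (r, i) (Finset.mk_mem_product (Finset.mem_univ _) hi)

theorem sum_mul_tsub_sum_mul {Ω κ : Type*} [Fintype κ] {V : κ → ℝ≥0 → Ω → ℝ≥0}
    (hV : ∀ r ω, Monotone fun t ↦ V r t ω)
    (c : κ → ℝ≥0) {s t : ℝ≥0} (hst : s ≤ t) (ω : Ω) :
    ∑ r, c r * V r t ω - ∑ r, c r * V r s ω = ∑ r, c r * (V r t ω - V r s ω) := by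
  have h : ∀ r, c r * V r t ω = c r * (V r t ω - V r s ω) + c r * V r s ω := fun r ↦ by
    rw [← mul_add, tsub_add_cancel_of_le (hV r ω hst)]
  rw [Finset.sum_congr rfl fun r _ ↦ h r, Finset.sum_add_distrib, add_tsub_cancel_right]

section WeightedSum
variable {Ω κ : Type*} [MeasurableSpace Ω] {P : Measure Ω} [Fintype κ]

/-- A nonnegative linear combination of independent subordinators is a subordinator. -/
theorem IsSubordinator.sum_mul {V : κ → ℝ≥0 → Ω → ℝ≥0}
    (hV : ∀ r, IsSubordinator P (V r)) (hind : iIndepFun (fun r ω t ↦ V r t ω) P) (c : κ → ℝ≥0) :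
    IsSubordinator P (fun t ω ↦ ∑ r, c r * V r t ω) where
  measurable t := Finset.measurable_fun_sum _ fun r _ ↦ ((hV r).measurable t).const_mul _
  zero ω := by simp [(hV _).zero]
  mono ω s t hst := Finset.sum_le_sum fun r _ ↦ mul_le_mul_right ((hV r).mono ω hst) _
  right_cont ω t :=
    tendsto_finsetSum _ fun r _ ↦ ((hV r).right_cont ω t).const_mul (c r)
  indep_increments := by
    intro n t ht
    have hle : ∀ i : Fin n, t i.castSucc ≤ t i.succ := fun i ↦ ht (Fin.castSucc_le_succ i)
    simp_rw [fun (i : Fin n) ω ↦ sum_mul_tsub_sum_mul (fun r ↦ (hV r).mono) c (hle i) ω]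
    have hZ : iIndepFun (fun (i : Fin n) ω (r : κ) ↦
        V r (t i.succ) ω - V r (t i.castSucc) ω) P := by
      refine iIndepFun_pi_columns
        (Z := fun r (i : Fin n) ω ↦ V r (t i.succ) ω - V r (t i.castSucc) ω)
        (fun r i ↦ ((hV r).measurable _).sub ((hV r).measurable _)) ?_
      refine iIndepFun_uncurry' (X := fun r (i : Fin n) ω ↦ V r (t i.succ) ω - V r (t i.castSucc) ω)
        (fun r i ↦ ((hV r).measurable _).sub ((hV r).measurable _)) ?_
        fun r ↦ (hV r).indep_increments n t ht
      exact hind.comp (fun r f (i : Fin n) ↦ f (t i.succ) - f (t i.castSucc)) fun r ↦ by fun_prop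
    exact hZ.comp (fun i x ↦ ∑ r, c r * x r) fun i ↦ by fun_prop
  stationary_increments s t hst := by
    simp_rw [fun ω ↦ sum_mul_tsub_sum_mul (fun r ↦ (hV r).mono) c hst ω]
    have h := IdentDistrib.pi (fun r ↦ (hV r).stationary_increments s t hst)
      (hind.comp (fun r f ↦ f t - f s) fun r ↦ by fun_prop)
      (hind.comp (fun r f ↦ f (t - s)) fun r ↦ by fun_prop)
    exact h.comp (u := fun x ↦ ∑ r, c r * x r) (by fun_prop)

theorem HasLaplaceExponent.sum_mul {V : κ → ℝ≥0 → Ω → ℝ≥0} {φ : κ → ℝ≥0 → ℝ}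
    (hm : ∀ r t, Measurable (V r t)) (hV : ∀ r, HasLaplaceExponent P (V r) (φ r))
    (hind : iIndepFun (fun r ω t ↦ V r t ω) P) (c : κ → ℝ≥0) :
    HasLaplaceExponent P (fun t ω ↦ ∑ r, c r * V r t ω) (fun μ ↦ ∑ r, φ r (c r * μ)) := by
  intro t μ
  have h := iIndepFun.integral_fun_prod_comp (X := fun r ω ↦ V r t ω)
    (hind.comp (fun r f ↦ f t) fun r ↦ by fun_prop) (fun r ↦ (hm r t).aemeasurable)
    (f := fun r x ↦ Real.exp (-((c r * μ : ℝ≥0) * (x : ℝ)))) (fun r ↦ by fun_prop)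
  simp only [hV _ t _, ← Real.exp_sum] at h
  convert h using 1
  · refine integral_congr_ae (.of_forall fun ω ↦ ?_)
    simp only [NNReal.coe_sum, NNReal.coe_mul, Finset.mul_sum, Finset.sum_neg_distrib]
    congr 2
    exact Finset.sum_congr rfl fun r _ ↦ by ring
  · rw [Finset.sum_neg_distrib, Finset.mul_sum]

end WeightedSum

/-- The binomial theorem, without the term of `r = 0`: the weights are such that their powers of
exponent `ν * r` are the binomial coefficients and the powers of `η`. -/
theorem sum_weight_mul_rpow (η μ : ℝ≥0) {ν : ℝ} {n : ℕ}
    (hν : ∀ r : Finset.Icc 1 n, 0 < ν * ((r : ℕ) : ℝ)) :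
    ∑ r : Finset.Icc 1 n, ((n.choose (r : ℕ) : ℝ≥0) ^ (1 / (ν * ((r : ℕ) : ℝ))) *
        η ^ (((n : ℝ) - ((r : ℕ) : ℝ)) / (ν * ((r : ℕ) : ℝ))) * μ) ^ (ν * ((r : ℕ) : ℝ)) =
      (η + μ ^ ν) ^ n - η ^ n := by
  have hterm : ∀ r : Finset.Icc 1 n, ((n.choose (r : ℕ) : ℝ≥0) ^ (1 / (ν * ((r : ℕ) : ℝ))) *
        η ^ (((n : ℝ) - ((r : ℕ) : ℝ)) / (ν * ((r : ℕ) : ℝ))) * μ) ^ (ν * ((r : ℕ) : ℝ)) =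
      (μ ^ ν) ^ (r : ℕ) * η ^ (n - (r : ℕ)) * n.choose r := by
    intro r
    have hr := (hν r).ne'
    have hrn : (r : ℕ) ≤ n := (Finset.mem_Icc.1 r.2).2
    rw [NNReal.mul_rpow, NNReal.mul_rpow, ← NNReal.rpow_mul, ← NNReal.rpow_mul,
      div_mul_cancel₀ _ hr, div_mul_cancel₀ _ hr, NNReal.rpow_one, ← Nat.cast_sub hrn,
      NNReal.rpow_natCast, NNReal.rpow_mul, NNReal.rpow_natCast]
    ring
  rw [Finset.sum_congr rfl fun r _ ↦ hterm r,
    Finset.sum_coe_sort (Finset.Icc 1 n) fun r ↦ (μ ^ ν) ^ r * η ^ (n - r) * (n.choose r : ℝ≥0),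
    add_comm η, add_pow, Finset.range_eq_Ico, Finset.sum_eq_sum_Ico_succ_bot (Nat.succ_pos n)]
  simp only [pow_zero, Nat.sub_zero, Nat.choose_zero_right, Nat.cast_one, mul_one, one_mul,
    add_tsub_cancel_left]
  rfl

/-! ### Laplace exponents -/

section Laplace
variable {Ω : Type*} [MeasurableSpace Ω] {P : Measure Ω} [IsProbabilityMeasure P]
  {W T : ℝ≥0 → Ω → ℝ≥0}

theorem exp_neg_mul_coe_le_one (μ x : ℝ≥0) : Real.exp (-((μ : ℝ) * (x : ℝ))) ≤ 1 :=
  Real.exp_le_one_iff.2 (neg_nonpos.2 (by positivity))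

theorem integrable_exp_neg_mul_coe {X : Ω → ℝ≥0} (hX : Measurable X) (μ : ℝ≥0) :
    Integrable (fun ω ↦ Real.exp (-((μ : ℝ) * (X ω : ℝ)))) P := by
  refine Integrable.of_bound (by fun_prop) 1 (.of_forall fun ω ↦ ?_)
  rw [Real.norm_of_nonneg (by positivity)]
  exact exp_neg_mul_coe_le_one _ _

theorem HasLaplaceExponent.lintegral_eq {φ : ℝ≥0 → ℝ} (h : HasLaplaceExponent P W φ)
    (hm : ∀ t, Measurable (W t)) (t μ : ℝ≥0) :
    ∫⁻ ω, ENNReal.ofReal (Real.exp (-((μ : ℝ) * (W t ω : ℝ)))) ∂P =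
      ENNReal.ofReal (Real.exp (-((t : ℝ) * φ μ))) := by
  rw [← h t μ, ofReal_integral_eq_lintegral_ofReal (integrable_exp_neg_mul_coe (hm t) μ)
    (.of_forall fun ω ↦ (Real.exp_pos _).le)]

/-- The Laplace exponent of a subordinated process is the composition of the exponents. -/
theorem HasLaplaceExponent.timeChange (hW : IsSubordinator P W) (hT : IsSubordinator P T)
    (hind : IndepFun (fun ω t ↦ W t ω) (fun ω t ↦ T t ω) P) {ψ : ℝ≥0 → ℝ≥0} {φ : ℝ≥0 → ℝ}
    (hψ : HasLaplaceExponent P W fun μ ↦ (ψ μ : ℝ)) (hφ : HasLaplaceExponent P T φ) :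
    HasLaplaceExponent P (timeChange W T) fun μ ↦ φ (ψ μ) := by
  intro t μ
  have hYi : IndepFun (fun ω t ↦ W t ω) (T t) P :=
    hind.comp (φ := id) (ψ := fun f : ℝ≥0 → ℝ≥0 ↦ f t) measurable_id (by fun_prop)
  have h := lintegral_process_of_indepFun hW.measurable hW.right_cont (hT.measurable t) hYi
    (ι := Unit) (τ := fun _ ↦ id) (fun _ ↦ measurable_id)
    (g := fun x ↦ ENNReal.ofReal (Real.exp (-((μ : ℝ) * (x () : ℝ))))) (by fun_prop)
  simp only [id, hψ.lintegral_eq hW.measurable] at h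
  have h2 := hφ.lintegral_eq hT.measurable t (ψ μ)
  simp_rw [mul_comm (ψ μ : ℝ)] at h2
  have h3 := ofReal_integral_eq_lintegral_ofReal
    (integrable_exp_neg_mul_coe (P := P) (measurable_timeChange hW hT t) μ)
    (.of_forall fun ω ↦ (Real.exp_pos _).le)
  replace h := h3.trans (h.trans h2)
  exact (ENNReal.ofReal_eq_ofReal_iff (integral_nonneg fun ω ↦ (Real.exp_pos _).le)
    (Real.exp_pos _).le).1 h

/-- `P (W t = 0)` is the limit at infinity of the Laplace transform of `W t`. -/
theorem measure_eq_zero_of_tendsto_laplaceExponent {ψ : ℝ≥0 → ℝ}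
    (hψ : HasLaplaceExponent P W ψ) (hm : ∀ t, Measurable (W t))
    (hlim : Tendsto ψ atTop atTop) {t : ℝ≥0} (ht : 0 < t) : P (W t ⁻¹' {0}) = 0 := by
  have hle : ∀ μ : ℝ≥0, P (W t ⁻¹' {0}) ≤ ENNReal.ofReal (Real.exp (-((t : ℝ) * ψ μ))) := by
    intro μ
    rw [← hψ.lintegral_eq hm, ← lintegral_indicator_one (hm t (measurableSet_singleton 0))]
    refine lintegral_mono (Set.indicator_le' (fun ω hω ↦ ?_) fun _ _ ↦ zero_le)
    have : W t ω = 0 := hω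
    simp [this]
  have hto : Tendsto (fun μ ↦ ENNReal.ofReal (Real.exp (-((t : ℝ) * ψ μ)))) atTop (𝓝 0) := by
    rw [← ENNReal.ofReal_zero]
    refine (ENNReal.continuous_ofReal.tendsto 0).comp ?_
    exact Real.tendsto_exp_neg_atTop_nhds_zero.comp (hlim.const_mul_atTop (NNReal.coe_pos.2 ht))
  exact le_antisymm (ge_of_tendsto' hto hle) zero_le

end Laplace

/-! ### The Lévy measure -/

theorem lintegral_rpow_neg_mul_exp_neg_mul {α y : ℝ} (hα : α < 1) (hy : 0 < y) :
    ∫⁻ t in Set.Ioi (0 : ℝ), ENNReal.ofReal (t ^ (-α) * Real.exp (-(y * t))) =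
      ENNReal.ofReal (Real.Gamma (1 - α) * y ^ (α - 1)) := by
  have h := Real.integral_rpow_mul_exp_neg_mul_Ioi (sub_pos.2 hα) hy
  have hG := Real.Gamma_pos_of_pos (sub_pos.2 hα)
  rw [← ofReal_integral_eq_lintegral_ofReal]
  · rw [show (-α) = (1 - α) - 1 by ring, h, one_div, Real.inv_rpow hy.le, ← Real.rpow_neg hy.le,
      neg_sub, mul_comm]
  -- The integral is not the junk value `0` of a non-integrable function.
  · refine Integrable.of_integral_ne_zero ?_
    rw [show (-α) = (1 - α) - 1 by ring, h]
    positivity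
  · filter_upwards [ae_restrict_mem measurableSet_Ioi] with t ht
    have : (0 : ℝ) < t := ht
    positivity

/-- The fundamental theorem of calculus for the lower Lebesgue integral of a nonnegative continuous
function. -/
theorem lintegral_Ioc_eq_ofReal_sub {f F : ℝ → ℝ} {a b : ℝ} (hab : a ≤ b)
    (hF : ∀ y ∈ Set.Icc a b, HasDerivAt F (f y) y) (hf : ContinuousOn f (Set.Icc a b))
    (hf0 : ∀ y ∈ Set.Icc a b, 0 ≤ f y) :
    ∫⁻ y in Set.Ioc a b, ENNReal.ofReal (f y) = ENNReal.ofReal (F b - F a) := by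
  have hint : IntervalIntegrable f volume a b := hf.intervalIntegrable_of_Icc hab
  rw [← ofReal_integral_eq_lintegral_ofReal, ← intervalIntegral.integral_of_le hab,
    intervalIntegral.integral_eq_sub_of_hasDerivAt _ hint]
  · rwa [Set.uIcc_of_le hab]
  · exact (intervalIntegrable_iff_integrableOn_Ioc_of_le hab).1 hint
  · filter_upwards [ae_restrict_mem measurableSet_Ioc] with y hy
    exact hf0 y (Set.Ioc_subset_Icc_self hy)

/-- The difference of exponentials is `∫ y in a..b, t e^{-yt}`; exchanging the integrals leaves, for
each `y`, a Gamma integral in `t`. With `a = ξ` and `b = ξ + μ` this is the Lévy-Khintchine formula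
of the tempered stable subordinator. -/
theorem lintegral_exp_sub_exp_mul_rpow {α a b : ℝ} (h0 : 0 < α) (h1 : α < 1) (ha : 0 < a)
    (hab : a ≤ b) :
    ∫⁻ t in Set.Ioi (0 : ℝ), ENNReal.ofReal ((Real.exp (-(a * t)) - Real.exp (-(b * t))) *
        (α * (t ^ (-(1 + α)) / Real.Gamma (1 - α)))) =
      ENNReal.ofReal (b ^ α - a ^ α) := by
  have hG : 0 < Real.Gamma (1 - α) := Real.Gamma_pos_of_pos (sub_pos.2 h1)
  have step : ∀ t ∈ Set.Ioi (0 : ℝ),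
      ENNReal.ofReal ((Real.exp (-(a * t)) - Real.exp (-(b * t))) *
        (α * (t ^ (-(1 + α)) / Real.Gamma (1 - α)))) =
      ∫⁻ y in Set.Ioc a b, ENNReal.ofReal (α / Real.Gamma (1 - α)) *
        ENNReal.ofReal (t ^ (-α) * Real.exp (-(y * t))) := by
    intro t ht
    have ht : 0 < t := ht
    have hF : ∀ y ∈ Set.Icc a b, HasDerivAt
        (fun y ↦ -(t ^ (-(1 + α)) * Real.exp (-(y * t)))) (t ^ (-α) * Real.exp (-(y * t))) y := by
      intro y _
      have h := ((((hasDerivAt_id y).mul_const t).neg.exp).const_mul (t ^ (-(1 + α)))).neg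
      refine h.congr_deriv ?_
      have : t ^ (-α) = t ^ (-(1 + α)) * t := by
        rw [← Real.rpow_add_one ht.ne']; congr 1; ring
      rw [this]
      simp only [Pi.neg_apply, id]
      rw [neg_eq_neg_one_mul (y * t)]; ring
    rw [lintegral_const_mul _ (by fun_prop), lintegral_Ioc_eq_ofReal_sub hab hF (by fun_prop)
      (fun y _ ↦ by positivity), ← ENNReal.ofReal_mul (by positivity)]
    congr 1
    ring
  rw [setLIntegral_congr_fun measurableSet_Ioi step, lintegral_lintegral_swap]
  · have inner : ∀ y ∈ Set.Ioc a b,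
        (∫⁻ t in Set.Ioi (0 : ℝ), ENNReal.ofReal (α / Real.Gamma (1 - α)) *
          ENNReal.ofReal (t ^ (-α) * Real.exp (-(y * t)))) =
        ENNReal.ofReal (α * y ^ (α - 1)) := by
      intro y hy
      rw [lintegral_const_mul _ (by fun_prop),
        lintegral_rpow_neg_mul_exp_neg_mul h1 (ha.trans hy.1), ← ENNReal.ofReal_mul (by positivity)]
      congr 1
      field_simp
    rw [setLIntegral_congr_fun measurableSet_Ioc inner]
    refine lintegral_Ioc_eq_ofReal_sub hab
      (fun y hy ↦ Real.hasDerivAt_rpow_const (Or.inl (ha.trans_le hy.1).ne')) ?_ ?_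
    · exact continuousOn_const.mul (continuousOn_id.rpow_const
        fun y hy ↦ Or.inl (ha.trans_le hy.1).ne')
    · intro y hy
      have := ha.trans_le hy.1
      positivity
  · refine Measurable.aemeasurable ?_
    simp only [Function.uncurry_def]
    fun_prop

section LevyMeasure
variable {Ω : Type*} [MeasurableSpace Ω] {P : Measure Ω} [IsProbabilityMeasure P]
  {W T : ℝ≥0 → Ω → ℝ≥0}

/-- The density on `(0, ∞)` of the Lévy measure of a tempered `α`-stable subordinator with
tempering parameter `ξ`. -/
noncomputable def temperedStableDensity (α ξ t : ℝ) : ℝ≥0∞ :=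
  ENNReal.ofReal (Real.exp (-(ξ * t)) * (α * (t ^ (-(1 + α)) / Real.Gamma (1 - α))))

theorem measurable_temperedStableDensity (α ξ : ℝ) : Measurable (temperedStableDensity α ξ) := by
  unfold temperedStableDensity
  fun_prop

/-- The image under `(t, ω) ↦ W t ω` of the product of the Lévy measure of a tempered stable
subordinator with `P`, that is, the mixture of the laws of `W t` over that Lévy measure. -/
noncomputable def subordinatedLevyMeasure (P : Measure Ω) (W : ℝ≥0 → Ω → ℝ≥0) (α ξ : ℝ) :
    Measure ℝ≥0 :=
  (((volume.restrict (Set.Ioi (0 : ℝ))).withDensity (temperedStableDensity α ξ)).prod P).map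
    fun p ↦ W p.1.toNNReal p.2

theorem lintegral_subordinatedLevyMeasure (hW : IsSubordinator P W) (α ξ : ℝ) {f : ℝ≥0 → ℝ≥0∞}
    (hf : Measurable f) :
    ∫⁻ x, f x ∂(subordinatedLevyMeasure P W α ξ) =
      ∫⁻ t in Set.Ioi (0 : ℝ), temperedStableDensity α ξ t * ∫⁻ ω, f (W t.toNNReal ω) ∂P := by
  have hm : Measurable fun p : ℝ × Ω ↦ W p.1.toNNReal p.2 :=
    (measurable_uncurry_of_right_cont hW.measurable hW.right_cont).comp
      ((measurable_real_toNNReal.comp measurable_fst).prodMk measurable_snd)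
  rw [subordinatedLevyMeasure, lintegral_map hf hm,
    lintegral_prod (fun p : ℝ × Ω ↦ f (W p.1.toNNReal p.2)) (hf.comp hm).aemeasurable]
  exact lintegral_withDensity_eq_lintegral_mul _ (measurable_temperedStableDensity α ξ)
    (hf.comp hm).lintegral_prod_right'

theorem subordinatedLevyMeasure_apply (hW : IsSubordinator P W) (α ξ : ℝ) {B : Set ℝ≥0}
    (hB : MeasurableSet B) :
    subordinatedLevyMeasure P W α ξ B =
      ∫⁻ t in Set.Ioi (0 : ℝ), temperedStableDensity α ξ t * P (W t.toNNReal ⁻¹' B) := by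
  rw [← lintegral_indicator_one hB,
    lintegral_subordinatedLevyMeasure hW α ξ (measurable_one.indicator hB)]
  refine lintegral_congr fun t ↦ ?_
  rw [← lintegral_indicator_one (hW.measurable _ hB)]
  rfl

/-- The Lévy-Khintchine integral against `subordinatedLevyMeasure`: the inner expectation is
`1 - e^{-t ψ(μ)}`, and what remains is the integral for the tempered stable subordinator at
`ψ(μ)`. -/
theorem lintegral_one_sub_exp_subordinatedLevyMeasure (hW : IsSubordinator P W) {α ξ : ℝ}
    (h0 : 0 < α) (h1 : α < 1) (hξ : 0 < ξ) {ψ : ℝ≥0 → ℝ≥0}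
    (hψ : HasLaplaceExponent P W fun μ ↦ (ψ μ : ℝ)) (μ : ℝ≥0) :
    ∫⁻ x : ℝ≥0, ENNReal.ofReal (1 - Real.exp (-((μ : ℝ) * (x : ℝ))))
        ∂(subordinatedLevyMeasure P W α ξ) =
      ENNReal.ofReal ((ξ + ψ μ) ^ α - ξ ^ α) := by
  have hG : 0 < Real.Gamma (1 - α) := Real.Gamma_pos_of_pos (sub_pos.2 h1)
  rw [lintegral_subordinatedLevyMeasure hW α ξ (by fun_prop),
    ← lintegral_exp_sub_exp_mul_rpow h0 h1 hξ (le_add_of_nonneg_right (ψ μ).coe_nonneg)]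
  refine setLIntegral_congr_fun measurableSet_Ioi fun t ht ↦ ?_
  have ht : 0 < t := ht
  have hint := integrable_exp_neg_mul_coe (P := P) (hW.measurable t.toNNReal) μ
  have hinner : ∫⁻ ω, ENNReal.ofReal (1 - Real.exp (-((μ : ℝ) * (W t.toNNReal ω : ℝ)))) ∂P =
      ENNReal.ofReal (1 - Real.exp (-(t * ψ μ))) := by
    have hsub : Integrable (fun ω ↦ 1 - Real.exp (-((μ : ℝ) * (W t.toNNReal ω : ℝ)))) P :=
      (integrable_const 1).sub hint
    rw [← ofReal_integral_eq_lintegral_ofReal hsub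
        (.of_forall fun ω ↦ sub_nonneg.2 (exp_neg_mul_coe_le_one _ _)),
      integral_sub (integrable_const 1) hint, hψ, Real.coe_toNNReal t ht.le]
    simp
  simp only [hinner, temperedStableDensity]
  rw [← ENNReal.ofReal_mul (by positivity)]
  congr 1
  rw [show -((ξ + ψ μ) * t) = -(ξ * t) + -(t * ψ μ) by ring, Real.exp_add]
  ring

/-- Written with `1 * x` so as to match the Lévy-Khintchine integrand at `μ = 1`. It follows from
`e^{-x} ≤ 1 / (1 + x)`. -/
theorem min_one_le_two_mul_one_sub_exp (x : ℝ≥0) :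
    min 1 (x : ℝ≥0∞) ≤ 2 * ENNReal.ofReal (1 - Real.exp (-(((1 : ℝ≥0) : ℝ) * (x : ℝ)))) := by
  have hx : (0 : ℝ) ≤ x := x.2
  have h1 : Real.exp (-(x : ℝ)) ≤ 1 / (1 + x) := by
    rw [Real.exp_neg, ← one_div]
    exact one_div_le_one_div_of_le (by positivity) (by linarith [Real.add_one_le_exp (x : ℝ)])
  have h2 : min 1 (x : ℝ) ≤ 2 * (1 - 1 / (1 + x)) := by
    rw [one_sub_div (by positivity), add_sub_cancel_left, mul_div_assoc',
      le_div_iff₀ (by positivity)]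
    rcases le_total (x : ℝ) 1 with h | h
    · rw [min_eq_right h]; nlinarith
    · rw [min_eq_left h]; linarith
  have h3 : min 1 (x : ℝ≥0∞) = ENNReal.ofReal (min 1 (x : ℝ)) := by
    rw [ENNReal.ofReal_min, ENNReal.ofReal_one, ENNReal.ofReal_coe_nnreal]
  rw [h3, NNReal.coe_one, one_mul, ← ENNReal.ofReal_ofNat 2, ← ENNReal.ofReal_mul (by norm_num)]
  exact ENNReal.ofReal_le_ofReal (by linarith)

theorem hasDriftAndLevyMeasure_timeChange (hW : IsSubordinator P W) {α ξ : ℝ}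
    (h0 : 0 < α) (h1 : α < 1) (hξ : 0 < ξ) {ψ : ℝ≥0 → ℝ≥0}
    (hψ : HasLaplaceExponent P W fun μ ↦ (ψ μ : ℝ))
    (hlim : Tendsto (fun μ ↦ (ψ μ : ℝ)) atTop atTop)
    (hX : HasLaplaceExponent P (timeChange W T) fun μ ↦ (ξ + ψ μ) ^ α - ξ ^ α) :
    HasDriftAndLevyMeasure P (timeChange W T) 0 (subordinatedLevyMeasure P W α ξ) where
  concentrated := by
    rw [subordinatedLevyMeasure_apply hW α ξ (measurableSet_singleton 0)]
    refine (setLIntegral_congr_fun measurableSet_Ioi fun t ht ↦ ?_).trans lintegral_zero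
    rw [measure_eq_zero_of_tendsto_laplaceExponent hψ hW.measurable hlim
      (Real.toNNReal_pos.2 ht), mul_zero]
  lintegral_lt_top := by
    refine (lintegral_mono min_one_le_two_mul_one_sub_exp).trans_lt ?_
    rw [lintegral_const_mul _ (by fun_prop),
      lintegral_one_sub_exp_subordinatedLevyMeasure hW h0 h1 hξ hψ]
    exact ENNReal.mul_lt_top (by simp) ENNReal.ofReal_lt_top
  laplace := by
    convert hX using 2 with μ
    rw [integral_eq_lintegral_of_nonneg_ae
        (.of_forall fun x ↦ sub_nonneg.2 (exp_neg_mul_coe_le_one _ _)) (by fun_prop),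
      lintegral_one_sub_exp_subordinatedLevyMeasure hW h0 h1 hξ hψ, ENNReal.toReal_ofReal]
    · simp
    · exact sub_nonneg.2 (Real.rpow_le_rpow hξ.le (le_add_of_nonneg_right (ψ μ).coe_nonneg) h0.le)

end LevyMeasure

/-! ### Adaptedness and the subordinated weighted sum -/

theorem measurable_sigmaAt_timeChange {Ω : Type*} {mΩ : MeasurableSpace Ω} {P : Measure Ω}
    {𝓕 : Filtration ℝ≥0 mΩ} {W : ℝ≥0 → Ω → ℝ≥0} (hW : IsSubordinator P W) (hWa : Adapted 𝓕 W)
    (T : ℝ≥0 → Ω → ℝ≥0) (t : ℝ≥0) : Measurable[sigmaAt 𝓕 (T t)] (timeChange W T t) := by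
  have hle : MeasurableSpace.comap (fun ω ↦ (W (T t ω) ω : ℝ)) inferInstance ≤
      sigmaAt 𝓕 (T t) := by
    refine le_iSup₂_of_le (fun u ω ↦ (W u ω : ℝ)) ⟨fun u ↦ (hWa u).coe_nnreal_real,
      fun ω u ↦ ?_, fun ω u ↦ ?_⟩ le_rfl
    · exact NNReal.continuous_coe.continuousAt.comp_continuousWithinAt (hW.right_cont ω u)
    · exact ⟨_, (NNReal.continuous_coe.tendsto _).comp ((hW.mono ω).tendsto_nhdsLT u)⟩
  have hm : Measurable[sigmaAt 𝓕 (T t)] fun ω ↦ (W (T t ω) ω : ℝ) :=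
    measurable_iff_comap_le.2 hle
  have h := hm.real_toNNReal
  simp only [Real.toNNReal_coe] at h
  exact h

theorem theorem2p2 {Ω : Type*} {mΩ : MeasurableSpace Ω} (P : Measure Ω) [IsProbabilityMeasure P]
    (𝓕 : Filtration ℝ≥0 mΩ)
    (η : ℝ≥0) (hη : 0 < η) (ν δ : ℝ) (hδ : 0 < δ) (n : ℕ) (hn : ⌈δ⌉₊ = n)
    (hν : ∀ r : Finset.Icc 1 n, 0 < ν * ((r : ℕ) : ℝ) ∧ ν * ((r : ℕ) : ℝ) < 1)
    -- the independent stable subordinators `V^{νr}`, `1 ≤ r ≤ n`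
    (V : Finset.Icc 1 n → ℝ≥0 → Ω → ℝ≥0)
    (hV : ∀ r : Finset.Icc 1 n, IsStableSubordinator P (ν * ((r : ℕ) : ℝ)) (V r))
    (hV_adapted : ∀ r, Adapted 𝓕 (V r))
    (hV_indep : iIndepFun (fun r ω t ↦ V r t ω) P)
    -- the independent tempered stable subordinator
    (T : ℝ≥0 → Ω → ℝ≥0)
    (hT : IsTemperedStableSubordinator P (δ / n) ((η : ℝ) ^ n) T)
    (hVT_indep : IndepFun (fun ω r t ↦ V r t ω) (fun ω t ↦ T t ω) P) :
    -- adaptedness to the subordinated family `𝓖_t = 𝓕_{T_t}`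
    (∀ t, Measurable[sigmaAt 𝓕 (T t)] (timeChange (weightedSum η ν n V) T t)) ∧
    IsSubordinator P (timeChange (weightedSum η ν n V) T) ∧
    HasLaplaceExponent P (timeChange (weightedSum η ν n V) T)
      (fun μ ↦ ((η : ℝ) + (μ : ℝ) ^ ν) ^ δ - (η : ℝ) ^ δ) ∧
    (δ < n → ∃ m : Measure ℝ≥0,
      (∀ B : Set ℝ≥0, MeasurableSet B →
        m B = ∫⁻ t in Set.Ioi (0 : ℝ),
          ENNReal.ofReal (Real.exp (-((η : ℝ) ^ n * t)) *
            (δ / n * (t ^ (-(1 + δ / n)) / Real.Gamma (1 - δ / n)))) *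
          P {ω | weightedSum η ν n V t.toNNReal ω ∈ B}) ∧
      HasDriftAndLevyMeasure P (timeChange (weightedSum η ν n V) T) 0 m) := by
  have hn0 : 0 < n := hn ▸ Nat.ceil_pos.2 hδ
  have hn1 : (1 : ℕ) ∈ Finset.Icc 1 n := Finset.mem_Icc.2 ⟨le_rfl, hn0⟩
  -- The hypothesis on `ν * r` at `r = 1`; the index set is nonempty since `δ > 0`.
  have hν0 : 0 < ν := by simpa using (hν ⟨1, hn1⟩).1
  have hnR : (0 : ℝ) < n := Nat.cast_pos.2 hn0
  have hηR : (0 : ℝ) < η := hη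
  have hW : IsSubordinator P (weightedSum η ν n V) :=
    IsSubordinator.sum_mul (fun r ↦ (hV r).isSubordinator) hV_indep _
  have hWa : Adapted 𝓕 (weightedSum η ν n V) := fun t ↦
    Finset.measurable_fun_sum _ fun r _ ↦ (hV_adapted r t).const_mul _
  have hWT : IndepFun (fun ω t ↦ weightedSum η ν n V t ω) (fun ω t ↦ T t ω) P :=
    hVT_indep.comp (ψ := id) (φ := fun (f : Finset.Icc 1 n → ℝ≥0 → ℝ≥0) (t : ℝ≥0) ↦
      ∑ r : Finset.Icc 1 n, (n.choose (r : ℕ) : ℝ≥0) ^ (1 / (ν * ((r : ℕ) : ℝ))) *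
        η ^ (((n : ℝ) - ((r : ℕ) : ℝ)) / (ν * ((r : ℕ) : ℝ))) * f r t)
      (by fun_prop) measurable_id
  -- The Laplace exponent of the weighted sum. The subtraction of `ℝ≥0` does not truncate here, and
  -- its values stay in `ℝ≥0`, where the exponent of `T` is to be evaluated.
  obtain ⟨ψ, hψ⟩ : ∃ ψ : ℝ≥0 → ℝ≥0, ψ = fun μ ↦ (η + μ ^ ν) ^ n - η ^ n := ⟨_, rfl⟩
  have hψR : ∀ μ : ℝ≥0, (ψ μ : ℝ) = ((η : ℝ) + (μ : ℝ) ^ ν) ^ n - (η : ℝ) ^ n := fun μ ↦ by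
    rw [hψ, NNReal.coe_sub (pow_le_pow_left₀ zero_le (le_add_of_nonneg_right zero_le) n)]
    push_cast
    rfl
  have hWψ : HasLaplaceExponent P (weightedSum η ν n V) fun μ ↦ (ψ μ : ℝ) := by
    have h := HasLaplaceExponent.sum_mul (fun r ↦ (hV r).isSubordinator.measurable)
      (fun r ↦ (hV r).laplace) hV_indep fun r : Finset.Icc 1 n ↦
        (n.choose (r : ℕ) : ℝ≥0) ^ (1 / (ν * ((r : ℕ) : ℝ))) *
          η ^ (((n : ℝ) - ((r : ℕ) : ℝ)) / (ν * ((r : ℕ) : ℝ)))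
    intro t μ
    refine (h t μ).trans ?_
    beta_reduce
    congr 3
    simp only [hψ]
    rw [← sum_weight_mul_rpow η μ fun r ↦ (hν r).1]
    push_cast
    rfl
  have hXφ := HasLaplaceExponent.timeChange hW hT.isSubordinator hWT hWψ hT.laplace
  refine ⟨measurable_sigmaAt_timeChange hW hWa T, hW.timeChange hT.isSubordinator hWT, ?_, ?_⟩
  · convert hXφ using 2 with μ
    rw [hψR, add_sub_cancel, ← Real.rpow_natCast_mul (by positivity),
      ← Real.rpow_natCast_mul hηR.le, mul_div_cancel₀ _ hnR.ne']
  · intro hlt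
    refine ⟨subordinatedLevyMeasure P (weightedSum η ν n V) (δ / n) ((η : ℝ) ^ n),
      fun B hB ↦ subordinatedLevyMeasure_apply hW _ _ hB, ?_⟩
    refine hasDriftAndLevyMeasure_timeChange hW (div_pos hδ hnR) ((div_lt_one hnR).2 hlt)
      (pow_pos hηR n) hWψ ?_ hXφ
    simp_rw [hψR]
    refine tendsto_atTop_add_const_right _ _ ((tendsto_pow_atTop hn0.ne').comp
      (tendsto_atTop_add_const_left _ _ ?_))
    exact (tendsto_rpow_atTop hν0).comp (NNReal.tendsto_coe_atTop.2 tendsto_id)
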